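/- Let $n\ge 1$ and let $\mathbb R^n$ carry the Euclidean norm. Let $\Gamma_0(\mathbb R^n)$ be the set of proper lower semicontinuous convex functions $f:\mathbb R^n\to\mathbb R\cup\{+\infty\}$. For $f\in\Gamma_0(\mathbb R^n)$ let $$e_1f(x):=\inf_{y\in\mathbb R^n}\Big\{f(y)+\tfrac12\|y-x\|^2\Big\}$$ be its Moreau envelope, which is finite everywhere, and let $e_1(\Gamma_0(\mathbb R^n)):=\{e_1f:\ f\in\Gamma_0(\mathbb R^n)\}$. Define the metrics $$\tilde d(g,h):=\sum_{i=1}^\infty\frac1{2^i}\,\frac{\|g-h\|_i}{1+\|g-h\|_i},\qquad \|g-h\|_i:=\sup_{\|x\|\le i}|g(x)-h(x)|\qquad(g,h\in e_1(\Gamma_0(\mathbb R^n))),$$ and $d(f_1,f_2):=\tilde d(e_1f_1,e_1f_2)$ for $f_1,f_2\in\Gamma_0(\mathbb R^n)$. A function $f$ is called strongly convex if there is $\sigma>0$ such that $f-\frac{\sigma}{2}\|\cdot\|^2$ is convex. Then the set of strongly convex functions in $e_1(\Gamma_0(\mathbb R^n))$ is meagre (a countable union of nowhere dense sets) in the metric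 space $(e_1(\Gamma_0(\mathbb R^n)),\tilde d)$, and the set of strongly convex functions in $\Gamma_0(\mathbb R^n)$ is meagre in the metric space $(\Gamma_0(\mathbb R^n),d)$. -/

import Mathlib

namespace MoreauSpace

/-- Euclidean space of dimension `n`, with the Euclidean norm. -/
abbrev Rn (n : ℕ) := EuclideanSpace ℝ (Fin n)

/-- `f` never takes the value `-∞` and is finite at some point. -/
def IsProper {n : ℕ} (f : Rn n → EReal) : Prop :=
  (∀ x, f x ≠ ⊥) ∧ ∃ x, f x < ⊤

/-- Convexity of an extended-real-valued function: the convexity inequality on its domain. -/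
def IsConvex {n : ℕ} (f : Rn n → EReal) : Prop :=
  ∀ x y : Rn n, f x < ⊤ → f y < ⊤ → ∀ α : ℝ, 0 ≤ α → α ≤ 1 →
    f (α • x + (1 - α) • y) ≤ (α : EReal) * f x + ((1 - α : ℝ) : EReal) * f y

/-- The class of proper lower semicontinuous convex functions. -/
structure IsGamma0 {n : ℕ} (f : Rn n → EReal) : Prop where
  proper : IsProper f
  lsc : LowerSemicontinuous f
  convex : IsConvex f

/-- The Moreau envelope `e_lam f`. -/
noncomputable def moreauEnvelope {n : ℕ} (lam : ℝ) (f : Rn n → EReal) : Rn n → EReal :=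
  fun x => ⨅ y : Rn n, f y + ((1 / (2 * lam) * ‖y - x‖ ^ 2 : ℝ) : EReal)

/-- `f - (σ/2)‖·‖²` is convex for some modulus `σ > 0`. -/
def IsStronglyConvex {n : ℕ} (f : Rn n → EReal) : Prop :=
  ∃ σ : ℝ, 0 < σ ∧ IsConvex (fun x => f x - ((σ / 2 * ‖x‖ ^ 2 : ℝ) : EReal))

/-- `‖f - g‖_i`, the supremum of `|f - g|` over the closed ball of radius `i` about the origin.
It is applied to Moreau envelopes of proper lsc convex functions only; these are finite and bounded
on balls (`isLocBdd_moreauEnvelope`), so neither `toReal` nor the supremum takes a junk value. -/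
noncomputable def supDist {n : ℕ} (i : ℕ) (f g : Rn n → EReal) : ℝ :=
  ⨆ x : Metric.closedBall (0 : Rn n) (i : ℝ), |(f x).toReal - (g x).toReal|

/-- The distance `∑_{i ≥ 1} 2^{-i} ‖f - g‖_i / (1 + ‖f - g‖_i)`. -/
noncomputable def envDist {n : ℕ} (f g : Rn n → EReal) : ℝ :=
  ∑' i : ℕ, (1 / 2 ^ (i + 1)) * (supDist (i + 1) f g / (1 + supDist (i + 1) f g))

/-- The set of proper lsc convex functions on `Rn n`, as a type. -/
@[ext] structure Gamma0 (n : ℕ) where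
  toFun : Rn n → EReal
  isGamma0 : IsGamma0 toFun

/-- The set of Moreau envelopes (with parameter `1`) of proper lsc convex functions, as a type. -/
@[ext] structure MoreauSet (n : ℕ) where
  toFun : Rn n → EReal
  exists_eq : ∃ f : Rn n → EReal, IsGamma0 f ∧ toFun = moreauEnvelope 1 f

/-! The two spaces are made metric spaces; the lemmas below serve that purpose only. -/

/-- Finite everywhere and bounded on bounded sets. -/
def IsLocBdd {n : ℕ} (f : Rn n → EReal) : Prop :=
  (∀ x, f x ≠ ⊥ ∧ f x ≠ ⊤) ∧ ∀ R : ℝ, ∃ C : ℝ, ∀ x, ‖x‖ ≤ R → |(f x).toReal| ≤ C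

section dist
variable {n : ℕ} {f g h : Rn n → EReal}

lemma bddAbove_supDist (hf : IsLocBdd f) (hg : IsLocBdd g) (i : ℕ) :
    BddAbove (Set.range fun x : Metric.closedBall (0 : Rn n) (i : ℝ) =>
      |(f x).toReal - (g x).toReal|) := by
  obtain ⟨C, hC⟩ := hf.2 i
  obtain ⟨D, hD⟩ := hg.2 i
  refine ⟨C + D, ?_⟩
  rintro _ ⟨⟨x, hx⟩, rfl⟩
  have hx' : ‖x‖ ≤ (i : ℝ) := by simpa using hx
  exact (abs_sub _ _).trans (add_le_add (hC x hx') (hD x hx'))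

lemma supDist_nonneg (i : ℕ) (f g : Rn n → EReal) : 0 ≤ supDist i f g :=
  Real.iSup_nonneg fun _ => abs_nonneg _

lemma supDist_self (i : ℕ) (f : Rn n → EReal) : supDist i f f = 0 := by
  simp [supDist]

lemma supDist_comm (i : ℕ) (f g : Rn n → EReal) : supDist i f g = supDist i g f := by
  simp only [supDist, abs_sub_comm]

lemma le_supDist (hf : IsLocBdd f) (hg : IsLocBdd g) (i : ℕ) {x : Rn n} (hx : ‖x‖ ≤ i) :
    |(f x).toReal - (g x).toReal| ≤ supDist i f g :=
  le_ciSup (bddAbove_supDist hf hg i) ⟨x, by simpa using hx⟩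

lemma supDist_triangle (hf : IsLocBdd f) (hg : IsLocBdd g) (hh : IsLocBdd h) (i : ℕ) :
    supDist i f h ≤ supDist i f g + supDist i g h := by
  have : Nonempty (Metric.closedBall (0 : Rn n) (i : ℝ)) := ⟨⟨0, by simp⟩⟩
  refine ciSup_le ?_
  rintro ⟨x, hx⟩
  have hx' : ‖x‖ ≤ (i : ℝ) := by simpa using hx
  exact (abs_sub_le _ (g x).toReal _).trans
    (add_le_add (le_supDist hf hg i hx') (le_supDist hg hh i hx'))

lemma envTerm_nonneg (f g : Rn n → EReal) (i : ℕ) :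
    0 ≤ (1 / 2 ^ (i + 1) : ℝ) * (supDist (i + 1) f g / (1 + supDist (i + 1) f g)) := by
  have := supDist_nonneg (i + 1) f g
  positivity

lemma summable_envTerm (f g : Rn n → EReal) :
    Summable fun i : ℕ =>
      (1 / 2 ^ (i + 1) : ℝ) * (supDist (i + 1) f g / (1 + supDist (i + 1) f g)) := by
  have hs : Summable fun i : ℕ => (1 / 2 ^ (i + 1) : ℝ) := by
    have := (summable_nat_add_iff (f := fun i : ℕ => ((1 / 2 : ℝ)) ^ i) 1).2
      summable_geometric_two
    simpa [one_div, inv_pow] using this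
  refine Summable.of_nonneg_of_le (envTerm_nonneg f g) (fun i => ?_) hs
  have := supDist_nonneg (i + 1) f g
  refine mul_le_of_le_one_right (by positivity) ?_
  rw [div_le_one (by positivity)]
  linarith

lemma envDist_self (f : Rn n → EReal) : envDist f f = 0 := by
  simp [envDist, supDist_self]

lemma envDist_comm (f g : Rn n → EReal) : envDist f g = envDist g f := by
  simp only [envDist, supDist_comm _ f g]

lemma envDist_triangle (hf : IsLocBdd f) (hg : IsLocBdd g) (hh : IsLocBdd h) :
    envDist f h ≤ envDist f g + envDist g h := by
  rw [envDist, envDist, envDist, ← (summable_envTerm f g).tsum_add (summable_envTerm g h)]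
  refine (summable_envTerm f h).tsum_le_tsum (fun i => ?_)
    ((summable_envTerm f g).add (summable_envTerm g h))
  rw [← mul_add]
  refine mul_le_mul_of_nonneg_left ?_ (by positivity)
  have h1 := supDist_triangle hf hg hh (i + 1)
  have ha := supDist_nonneg (i + 1) f g
  have hb := supDist_nonneg (i + 1) g h
  have hc := supDist_nonneg (i + 1) f h
  generalize supDist (i + 1) f g = a at *
  generalize supDist (i + 1) g h = b at *
  generalize supDist (i + 1) f h = c at *
  calc c / (1 + c) ≤ (a + b) / (1 + (a + b)) := by
        rw [div_le_div_iff₀ (by positivity) (by positivity)]; nlinarith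
    _ = a / (1 + (a + b)) + b / (1 + (a + b)) := by ring
    _ ≤ a / (1 + a) + b / (1 + b) := by gcongr <;> linarith

lemma eq_of_envDist_eq_zero (hf : IsLocBdd f) (hg : IsLocBdd g) (h0 : envDist f g = 0) :
    f = g := by
  funext x
  have hz := (hasSum_zero_iff_of_nonneg (envTerm_nonneg f g)).1
    ((summable_envTerm f g).hasSum_iff.2 h0)
  obtain ⟨i, hi⟩ := exists_nat_ge ‖x‖
  have hN : supDist (i + 1) f g = 0 := by
    have := congrFun hz i
    have hn := supDist_nonneg (i + 1) f g
    have hp : (1 + supDist (i + 1) f g) ≠ 0 := by positivity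
    simpa [hp] using this
  have hle := le_supDist hf hg (i + 1) (x := x) (by push_cast; linarith)
  rw [hN] at hle
  have heq : (f x).toReal = (g x).toReal :=
    sub_eq_zero.1 (abs_eq_zero.1 (le_antisymm hle (abs_nonneg _)))
  rw [← EReal.coe_toReal (hf.1 x).2 (hf.1 x).1, ← EReal.coe_toReal (hg.1 x).2 (hg.1 x).1, heq]

end dist

section envelope
variable {n : ℕ} {f g : Rn n → EReal}

/-- A separating functional for a point strictly below the epigraph. -/
lemma exists_separation (hf : IsGamma0 f) {z : Rn n} {c : ℝ} (hc : (c : EReal) < f z) :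
    ∃ (v : Rn n) (β u : ℝ), 0 ≤ β ∧ inner ℝ v z + β * c < u ∧
      ∀ (y : Rn n) (t : ℝ), f y ≤ t → u < inner ℝ v y + β * t := by
  let A : Set (Rn n × ℝ) := {p | f p.1 ≤ (p.2 : EReal)}
  have hAc : IsClosed A :=
    (lowerSemicontinuous_iff_isClosed_epigraph.1 hf.lsc).preimage
      (f := fun p : Rn n × ℝ => (p.1, (p.2 : EReal)))
      (continuous_fst.prodMk (continuous_coe_real_ereal.comp continuous_snd))
  have hAv : Convex ℝ A := by
    rintro ⟨x, s⟩ hx ⟨y, t⟩ hy a b ha hb hab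
    have hx' : f x ≤ (s : EReal) := hx
    have hy' : f y ≤ (t : EReal) := hy
    have hba : b = 1 - a := by linarith
    subst hba
    have := hf.convex x y (hx'.trans_lt (EReal.coe_lt_top s)) (hy'.trans_lt (EReal.coe_lt_top t))
      a ha (by linarith)
    refine this.trans ?_
    change _ ≤ (((a * s + (1 - a) * t : ℝ)) : EReal)
    rw [EReal.coe_add, EReal.coe_mul, EReal.coe_mul]
    exact add_le_add (mul_le_mul_of_nonneg_left hx' (by exact_mod_cast ha))
      (mul_le_mul_of_nonneg_left hy' (by exact_mod_cast hb))
  obtain ⟨L, u, h1, h2⟩ := geometric_hahn_banach_point_closed (x := (z, c)) hAv hAc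
    (by simpa [A] using hc)
  let v : Rn n := (InnerProductSpace.toDual ℝ (Rn n)).symm (L.comp (.inl ℝ (Rn n) ℝ))
  have hL : ∀ (y : Rn n) (t : ℝ), L (y, t) = inner ℝ v y + L (0, 1) * t := by
    intro y t
    have e : ((y, t) : Rn n × ℝ) = (y, 0) + t • ((0 : Rn n), (1 : ℝ)) := by simp
    rw [e, map_add, map_smul, smul_eq_mul, mul_comm]
    simp [v]
  refine ⟨v, L (0, 1), u, ?_, hL z c ▸ h1, fun y t ht => hL y t ▸ h2 (y, t) ht⟩
  by_contra! hβ
  obtain ⟨x₀, hx₀⟩ := hf.proper.2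
  have hx₁ : f x₀ = ((f x₀).toReal : EReal) :=
    (EReal.coe_toReal hx₀.ne (hf.proper.1 x₀)).symm
  have key : ∀ t : ℝ, (f x₀).toReal ≤ t → u < inner ℝ v x₀ + L (0, 1) * t := by
    intro t ht
    rw [← hL]
    refine h2 (x₀, t) ?_
    change f x₀ ≤ (t : EReal)
    rw [hx₁]
    exact_mod_cast ht
  have := key (max (f x₀).toReal ((u - inner ℝ v x₀) / L (0, 1))) (le_max_left _ _)
  have h3 := mul_le_mul_of_nonpos_left
    (le_max_right (f x₀).toReal ((u - inner ℝ v x₀) / L (0, 1))) hβ.le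
  rw [mul_div_cancel₀ _ hβ.ne] at h3
  linarith

/-- A point strictly below the graph is strictly below some affine minorant. -/
lemma exists_affine_minorant (hf : IsGamma0 f) {z : Rn n} {c : ℝ} (hc : (c : EReal) < f z) :
    ∃ (v : Rn n) (r : ℝ), c < inner ℝ v z + r ∧
      ∀ y, ((inner ℝ v y + r : ℝ) : EReal) ≤ f y := by
  have fin : ∀ y, f y < ⊤ → f y = ((f y).toReal : EReal) := fun y hy =>
    (EReal.coe_toReal hy.ne (hf.proper.1 y)).symm
  have main : ∀ {z : Rn n} {c : ℝ} {v : Rn n} {β u : ℝ}, 0 < β → inner ℝ v z + β * c < u →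
      (∀ (y : Rn n) (t : ℝ), f y ≤ t → u < inner ℝ v y + β * t) →
      ∃ (v : Rn n) (r : ℝ), c < inner ℝ v z + r ∧
        ∀ y, ((inner ℝ v y + r : ℝ) : EReal) ≤ f y := by
    intro z c v β u hβ h1 h2
    have hr : ∀ y, inner ℝ (-(β⁻¹) • v) y + u / β = (u - inner ℝ v y) / β := by
      intro y
      rw [real_inner_smul_left]
      field_simp
      ring
    refine ⟨-(β⁻¹) • v, u / β, ?_, fun y => ?_⟩
    · rw [hr, lt_div_iff₀ hβ]; linarith
    · rw [hr]
      rcases (le_top : f y ≤ ⊤).lt_or_eq with hy | hy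
      · have := h2 y (f y).toReal (fin y hy).le
        rw [fin y hy]
        norm_cast
        rw [div_le_iff₀ hβ]; linarith
      · rw [hy]; exact le_top
  obtain ⟨v, β, u, hβ, h1, h2⟩ := exists_separation hf hc
  rcases hβ.lt_or_eq with hβ | rfl
  · exact main hβ h1 h2
  obtain ⟨x₀, hx₀⟩ := hf.proper.2
  obtain ⟨w, r, -, hw⟩ : ∃ (v : Rn n) (r : ℝ), (f x₀).toReal - 1 < inner ℝ v x₀ + r ∧
        ∀ y, ((inner ℝ v y + r : ℝ) : EReal) ≤ f y := by
    have hlt : (((f x₀).toReal - 1 : ℝ) : EReal) < f x₀ := by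
      conv_rhs => rw [fin x₀ hx₀]
      norm_cast
      linarith
    obtain ⟨v', β', u', hβ', h1', h2'⟩ := exists_separation hf hlt
    have := h2' x₀ _ (fin x₀ hx₀).le
    exact main (by nlinarith) h1' h2'
  simp only [zero_mul, add_zero] at h1 h2
  have hd : 0 < u - inner ℝ v z := by linarith
  obtain ⟨k, hk⟩ := exists_nat_gt ((c - (inner ℝ w z + r)) / (u - inner ℝ v z))
  rw [div_lt_iff₀ hd] at hk
  have hr : ∀ y, inner ℝ (w - (k : ℝ) • v) y + (r + k * u)
      = inner ℝ w y + r + k * (u - inner ℝ v y) := by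
    intro y
    rw [inner_sub_left, real_inner_smul_left]
    ring
  refine ⟨w - (k : ℝ) • v, r + k * u, by rw [hr]; linarith, fun y => ?_⟩
  rcases (le_top : f y ≤ ⊤).lt_or_eq with hy | hy
  · have h3 := h2 y _ (fin y hy).le
    refine le_trans ?_ (hw y)
    rw [hr]
    norm_cast
    have : (k : ℝ) * (u - inner ℝ v y) ≤ 0 :=
      mul_nonpos_of_nonneg_of_nonpos (by positivity) (by linarith)
    linarith
  · rw [hy]; exact le_top

lemma moreauEnvelope_le (f : Rn n → EReal) (x y : Rn n) :
    moreauEnvelope 1 f x ≤ f y + ((1 / 2 * ‖y - x‖ ^ 2 : ℝ) : EReal) := by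
  have := iInf_le (fun y : Rn n => f y + ((1 / (2 * 1) * ‖y - x‖ ^ 2 : ℝ) : EReal)) y
  simpa [moreauEnvelope] using this

/-- An affine minorant of `f` gives an affine minorant of its Moreau envelope. -/
lemma le_moreauEnvelope {v : Rn n} {r : ℝ} (h : ∀ y, ((inner ℝ v y + r : ℝ) : EReal) ≤ f y)
    (x : Rn n) :
    ((inner ℝ v x + r - 1 / 2 * ‖v‖ ^ 2 : ℝ) : EReal) ≤ moreauEnvelope 1 f x := by
  refine le_iInf fun y => le_trans ?_ (add_le_add_left (h y) _)
  rw [← EReal.coe_add]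
  norm_cast
  have h1 : 0 ≤ ‖(y - x) + v‖ ^ 2 := by positivity
  rw [norm_add_sq_real, real_inner_comm, inner_sub_right] at h1
  linarith

lemma isLocBdd_moreauEnvelope (hf : IsGamma0 f) : IsLocBdd (moreauEnvelope 1 f) := by
  obtain ⟨x₀, hx₀⟩ := hf.proper.2
  have hx₁ : f x₀ = ((f x₀).toReal : EReal) :=
    (EReal.coe_toReal hx₀.ne (hf.proper.1 x₀)).symm
  obtain ⟨v, r, -, hv⟩ := exists_affine_minorant hf (z := x₀) (c := (f x₀).toReal - 1) (by
    conv_rhs => rw [hx₁]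
    norm_cast
    linarith)
  have lo := le_moreauEnvelope hv
  have up : ∀ x, moreauEnvelope 1 f x ≤
      (((f x₀).toReal + 1 / 2 * ‖x₀ - x‖ ^ 2 : ℝ) : EReal) := fun x => by
    rw [EReal.coe_add, ← hx₁]
    exact moreauEnvelope_le f x x₀
  have hfin : ∀ x, moreauEnvelope 1 f x ≠ ⊥ ∧ moreauEnvelope 1 f x ≠ ⊤ := fun x =>
    ⟨((EReal.bot_lt_coe _).trans_le (lo x)).ne', ((up x).trans_lt (EReal.coe_lt_top _)).ne⟩
  refine ⟨hfin, fun R => ⟨|(f x₀).toReal| + 1 / 2 * (‖x₀‖ + R) ^ 2 +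
    (‖v‖ * R + |r| + 1 / 2 * ‖v‖ ^ 2), fun x hx => ?_⟩⟩
  have lo' := lo x
  have up' := up x
  rw [← EReal.coe_toReal (hfin x).2 (hfin x).1] at lo' up'
  replace lo' := EReal.coe_le_coe_iff.1 lo'
  replace up' := EReal.coe_le_coe_iff.1 up'
  have h1 : |inner ℝ v x| ≤ ‖v‖ * R :=
    (abs_real_inner_le_norm v x).trans (mul_le_mul_of_nonneg_left hx (norm_nonneg v))
  have h2 : ‖x₀ - x‖ ^ 2 ≤ (‖x₀‖ + R) ^ 2 :=
    pow_le_pow_left₀ (norm_nonneg _) ((norm_sub_le _ _).trans (by linarith)) 2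
  have h3 := abs_le.1 h1
  have h4 := neg_abs_le r
  have h5 := le_abs_self (f x₀).toReal
  have h6 := abs_nonneg (f x₀).toReal
  have h7 := abs_nonneg r
  have h8 : 0 ≤ ‖v‖ ^ 2 := by positivity
  have h9 : 0 ≤ (‖x₀‖ + R) ^ 2 := by positivity
  rw [abs_le]
  constructor <;> linarith

lemma le_of_moreauEnvelope_le (hf : IsGamma0 f) (hg : IsGamma0 g)
    (h : ∀ x, moreauEnvelope 1 g x ≤ moreauEnvelope 1 f x) (z : Rn n) : g z ≤ f z := by
  by_contra! hlt
  have hz : f z = ((f z).toReal : EReal) :=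
    (EReal.coe_toReal (hlt.trans_le le_top).ne (hf.proper.1 z)).symm
  rw [hz] at hlt
  obtain ⟨v, r, h1, h2⟩ := exists_affine_minorant hg hlt
  have h3 := (le_moreauEnvelope h2 (z + v)).trans
    ((h (z + v)).trans (moreauEnvelope_le f (z + v) z))
  rw [hz, ← EReal.coe_add] at h3
  replace h3 := EReal.coe_le_coe_iff.1 h3
  rw [inner_add_right, real_inner_self_eq_norm_sq] at h3
  simp only [sub_add_cancel_left, norm_neg] at h3
  linarith

lemma moreauEnvelope_injective (hf : IsGamma0 f) (hg : IsGamma0 g)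
    (h : moreauEnvelope 1 f = moreauEnvelope 1 g) : f = g :=
  funext fun z => le_antisymm (le_of_moreauEnvelope_le hg hf (fun x => (congrFun h x).le) z)
    (le_of_moreauEnvelope_le hf hg (fun x => (congrFun h x).ge) z)

end envelope

lemma MoreauSet.isLocBdd {n : ℕ} (g : MoreauSet n) : IsLocBdd g.toFun := by
  obtain ⟨f, hf, h⟩ := g.exists_eq
  exact h ▸ isLocBdd_moreauEnvelope hf

/-- The metric on the set of Moreau envelopes. -/
noncomputable instance (n : ℕ) : MetricSpace (MoreauSet n) where
  dist f g := envDist f.toFun g.toFun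
  dist_self f := envDist_self f.toFun
  dist_comm f g := envDist_comm f.toFun g.toFun
  dist_triangle f g h := envDist_triangle f.isLocBdd g.isLocBdd h.isLocBdd
  eq_of_dist_eq_zero {f g} h := MoreauSet.ext (eq_of_envDist_eq_zero f.isLocBdd g.isLocBdd h)

/-- The Attouch-Wets metric on the set of proper lsc convex functions. -/
noncomputable instance (n : ℕ) : MetricSpace (Gamma0 n) where
  dist f g := envDist (moreauEnvelope 1 f.toFun) (moreauEnvelope 1 g.toFun)
  dist_self f := envDist_self _
  dist_comm f g := envDist_comm _ _
  dist_triangle f g h := envDist_triangle (isLocBdd_moreauEnvelope f.isGamma0)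
    (isLocBdd_moreauEnvelope g.isGamma0) (isLocBdd_moreauEnvelope h.isGamma0)
  eq_of_dist_eq_zero {f g} h := Gamma0.ext <| moreauEnvelope_injective f.isGamma0 g.isGamma0 <|
    eq_of_envDist_eq_zero (isLocBdd_moreauEnvelope f.isGamma0)
      (isLocBdd_moreauEnvelope g.isGamma0) h

end MoreauSpace

namespace MoreauSpace

/-! Strong convexity with modulus at least `σ` is a closed condition on envelopes, since it is a
family of inequalities between point evaluations, and these are continuous for the metric
(`isClosed_setOf_isModulusConvex`). It remains to see that it has empty interior; the moduli `1 / (k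
+ 1)` then give a countable cover.

The metric barely sees what happens far from the origin (`envDist_le_of_eqOn_ball`). Replacing `f`
by its infimal convolution with `r * ‖·‖`, for `r` large, leaves the envelope unchanged on a given
ball and makes it grow at most linearly (`exists_moreauEnvelope_eqOn_linear_growth`). Strong
convexity forces quadratic growth, so every ball of the metric space contains an envelope that is
not strongly convex.

For `Γ₀`, the envelope map is an isometry onto the envelopes, and it sends modulus `σ` to modulus `σ
/ (1 + σ)`; so the second set lies in the preimage of the first meagre set. -/

variable {n : ℕ} {f g : Rn n → EReal}

/-- `f` is convex with modulus `σ`: the strong convexity inequality, tested against real upper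
bounds of the values of `f`. -/
def IsModulusConvex (σ : ℝ) (f : Rn n → EReal) : Prop :=
  ∀ (x y : Rn n) (a b : ℝ), f x ≤ a → f y ≤ b → ∀ α : ℝ, 0 ≤ α → α ≤ 1 →
    f (α • x + (1 - α) • y) ≤
      ((α * a + (1 - α) * b - σ / 2 * (α * (1 - α)) * ‖x - y‖ ^ 2 : ℝ) : EReal)

lemma IsModulusConvex.mono {σ τ : ℝ} (h : IsModulusConvex σ f) (hτ : τ ≤ σ) :
    IsModulusConvex τ f := by
  intro x y a b ha hb α h0 h1
  refine (h x y a b ha hb α h0 h1).trans ?_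
  norm_cast
  have h2 : 0 ≤ α * (1 - α) * ‖x - y‖ ^ 2 :=
    mul_nonneg (mul_nonneg h0 (by linarith)) (by positivity)
  nlinarith [mul_le_mul_of_nonneg_right hτ h2]

lemma norm_combo_sq (x y : Rn n) (α : ℝ) :
    ‖α • x + (1 - α) • y‖ ^ 2 =
      α * ‖x‖ ^ 2 + (1 - α) * ‖y‖ ^ 2 - α * (1 - α) * ‖x - y‖ ^ 2 := by
  rw [norm_add_sq_real, norm_sub_sq_real, norm_smul, norm_smul, mul_pow, mul_pow,
    Real.norm_eq_abs, Real.norm_eq_abs, sq_abs, sq_abs, real_inner_smul_left,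
    real_inner_smul_right]
  ring

lemma isModulusConvex_of_isConvex_sub (hf : ∀ x, f x ≠ ⊥) {σ : ℝ}
    (h : IsConvex (fun x => f x - ((σ / 2 * ‖x‖ ^ 2 : ℝ) : EReal))) : IsModulusConvex σ f := by
  intro x y a b ha hb α h0 h1
  have ex : ∀ x (a : ℝ), f x ≤ a → ∃ p : ℝ, f x = p ∧ p ≤ a := fun x a ha => by
    have e := EReal.coe_toReal (ha.trans_lt (EReal.coe_lt_top a)).ne (hf x)
    refine ⟨_, e.symm, ?_⟩
    rw [← e] at ha
    exact_mod_cast ha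
  obtain ⟨p, hp, hpa⟩ := ex x a ha
  obtain ⟨s, hs, hsb⟩ := ex y b hb
  have key := h x y (by simp only [hp]; rw [← EReal.coe_sub]; exact EReal.coe_lt_top _)
    (by simp only [hs]; rw [← EReal.coe_sub]; exact EReal.coe_lt_top _) α h0 h1
  simp only [hp, hs] at key
  rw [← EReal.coe_sub, ← EReal.coe_sub, ← EReal.coe_mul, ← EReal.coe_mul, ← EReal.coe_add] at key
  have hz : f (α • x + (1 - α) • y) ≠ ⊤ := by
    intro htop
    rw [htop, EReal.top_sub_coe] at key
    exact absurd (top_le_iff.1 key) (EReal.coe_ne_top _)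
  rw [← EReal.coe_toReal hz (hf _)] at key ⊢
  rw [← EReal.coe_sub, EReal.coe_le_coe_iff, norm_combo_sq] at key
  rw [EReal.coe_le_coe_iff]
  have h2 := mul_le_mul_of_nonneg_left hpa h0
  have h3 := mul_le_mul_of_nonneg_left hsb (sub_nonneg.2 h1)
  linarith

lemma isModulusConvex_zero (hf : ∀ x, f x ≠ ⊥) (h : IsConvex f) : IsModulusConvex 0 f :=
  isModulusConvex_of_isConvex_sub hf (by simpa using h)

lemma isConvex_of_isModulusConvex_zero (hf : ∀ x, f x ≠ ⊥) (h : IsModulusConvex 0 f) :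
    IsConvex f := by
  intro x y hx hy α h0 h1
  have ex := EReal.coe_toReal hx.ne (hf x)
  have ey := EReal.coe_toReal hy.ne (hf y)
  have := h x y _ _ ex.ge ey.ge α h0 h1
  rw [← ex, ← ey]
  simpa using this

/-! ### Infimal convolution and moduli of convexity -/

/-- The infimal convolution of `f` with (the reflection of) a real-valued kernel. -/
noncomputable def infConv (K : Rn n → ℝ) (f : Rn n → EReal) : Rn n → EReal :=
  fun x => ⨅ y, f y + (K (y - x) : EReal)

lemma moreauEnvelope_eq_infConv (f : Rn n → EReal) :
    moreauEnvelope 1 f = infConv (fun p => 1 / 2 * ‖p‖ ^ 2) f := by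
  funext x
  simp only [moreauEnvelope, mul_one]
  rfl

lemma infConv_le (K : Rn n → ℝ) (f : Rn n → EReal) (x y : Rn n) :
    infConv K f x ≤ f y + (K (y - x) : EReal) :=
  iInf_le (fun y => f y + (K (y - x) : EReal)) y

/-- Supplies near-minimizers as real upper bounds, the form in which `IsModulusConvex` takes its
data. -/
lemma exists_of_infConv_lt {K : Rn n → ℝ} {x : Rn n} {c : ℝ} (h : infConv K f x < c) :
    ∃ y, f y ≤ ((c - K (y - x) : ℝ) : EReal) := by
  obtain ⟨y, hy⟩ := iInf_lt_iff.1 h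
  refine ⟨y, ?_⟩
  rw [EReal.coe_sub]
  exact (EReal.le_sub_iff_add_le (Or.inl (EReal.coe_ne_bot _)) (Or.inl (EReal.coe_ne_top _))).2
    hy.le

/-- Infimal convolution with a convex kernel preserves convexity; the moduli combine. -/
lemma IsModulusConvex.infConv {σ ω τ : ℝ} {K : Rn n → ℝ} (hf : IsModulusConvex σ f)
    (hK : ∀ (p q : Rn n) (α : ℝ), 0 ≤ α → α ≤ 1 → K (α • p + (1 - α) • q) ≤
      α * K p + (1 - α) * K q - ω / 2 * (α * (1 - α)) * ‖p - q‖ ^ 2)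
    (hτ : ∀ p d : Rn n, τ * ‖d‖ ^ 2 ≤ σ * ‖p‖ ^ 2 + ω * ‖p - d‖ ^ 2) :
    IsModulusConvex τ (infConv K f) := by
  intro u v a b ha hb α h0 h1
  -- The infimum need not be attained, so both endpoints use near-minimizers with slack `z - c`,
  -- where `c` is the target bound; the convex combination of the slacks is again `z - c`.
  refine EReal.le_of_forall_lt_iff_le.1 fun z hz => ?_
  set c : ℝ := α * a + (1 - α) * b - τ / 2 * (α * (1 - α)) * ‖u - v‖ ^ 2
  have hε : 0 < z - c := by
    have : c < z := by exact_mod_cast hz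
    linarith
  obtain ⟨y₁, hy₁⟩ := exists_of_infConv_lt (f := f) (K := K) (x := u) (c := a + (z - c))
    (ha.trans_lt (by norm_cast; linarith))
  obtain ⟨y₂, hy₂⟩ := exists_of_infConv_lt (f := f) (K := K) (x := v) (c := b + (z - c))
    (hb.trans_lt (by norm_cast; linarith))
  refine (infConv_le K f _ (α • y₁ + (1 - α) • y₂)).trans
    ((add_le_add_left (hf y₁ y₂ _ _ hy₁ hy₂ α h0 h1) _).trans ?_)
  rw [← EReal.coe_add, EReal.coe_le_coe_iff]
  have e : α • y₁ + (1 - α) • y₂ - (α • u + (1 - α) • v)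
      = α • (y₁ - u) + (1 - α) • (y₂ - v) := by module
  have h2 := hK (y₁ - u) (y₂ - v) α h0 h1
  have h3 := hτ (y₁ - y₂) (u - v)
  have e' : y₁ - u - (y₂ - v) = y₁ - y₂ - (u - v) := by abel
  rw [e'] at h2
  rw [e]
  have h4 := mul_le_mul_of_nonneg_left h3 (mul_nonneg h0 (sub_nonneg.2 h1))
  simp only [c] at hε ⊢
  nlinarith

/-- The right side is least at `p = d / (1 + σ)`; completing the square there gives the constant. -/
lemma modulus_bound {σ : ℝ} (hσ : 0 ≤ σ) (p d : Rn n) :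
    σ / (1 + σ) * ‖d‖ ^ 2 ≤ σ * ‖p‖ ^ 2 + 1 * ‖p - d‖ ^ 2 := by
  have h : 0 ≤ ‖(1 + σ) • p - d‖ ^ 2 := by positivity
  rw [norm_sub_sq_real, norm_smul, mul_pow, real_inner_smul_left, Real.norm_eq_abs, sq_abs] at h
  rw [norm_sub_sq_real, div_mul_eq_mul_div, div_le_iff₀ (by positivity)]
  nlinarith

lemma IsModulusConvex.moreauEnvelope {σ : ℝ} (hσ : 0 ≤ σ) (hf : IsModulusConvex σ f) :
    IsModulusConvex (σ / (1 + σ)) (moreauEnvelope 1 f) := by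
  rw [moreauEnvelope_eq_infConv]
  refine hf.infConv (ω := 1) (fun p q α _ _ => ?_) (modulus_bound hσ)
  rw [norm_combo_sq]
  exact le_of_eq (by ring)

lemma isModulusConvex_moreauEnvelope (hf : IsGamma0 f) :
    IsModulusConvex 0 (moreauEnvelope 1 f) := by
  simpa using (isModulusConvex_zero hf.proper.1 hf.convex).moreauEnvelope le_rfl

/-! ### Lipschitz regularization and its envelope -/

lemma norm_kernel_convex {r : ℝ} (hr : 0 ≤ r) (p q : Rn n) (α : ℝ) (h0 : 0 ≤ α) (h1 : α ≤ 1) :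
    r * ‖α • p + (1 - α) • q‖ ≤
      α * (r * ‖p‖) + (1 - α) * (r * ‖q‖) - 0 / 2 * (α * (1 - α)) * ‖p - q‖ ^ 2 := by
  have h := norm_add_le (α • p) ((1 - α) • q)
  rw [norm_smul, norm_smul, Real.norm_of_nonneg h0, Real.norm_of_nonneg (sub_nonneg.2 h1)] at h
  nlinarith [mul_le_mul_of_nonneg_left h hr]

lemma exists_affine_minorant_of_isGamma0 (hf : IsGamma0 f) :
    ∃ (v : Rn n) (c : ℝ), ∀ y, ((inner ℝ v y + c : ℝ) : EReal) ≤ f y := by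
  obtain ⟨x₀, hx₀⟩ := hf.proper.2
  obtain ⟨v, c, -, h⟩ := exists_affine_minorant hf (z := x₀) (c := (f x₀).toReal - 1) (by
    conv_rhs => rw [← EReal.coe_toReal hx₀.ne (hf.proper.1 x₀)]
    norm_cast
    linarith)
  exact ⟨v, c, h⟩

/-- The Lipschitz regularization of a function in `Γ₀`, for a Lipschitz constant which dominates
the slope of an affine minorant, is again in `Γ₀`. -/
lemma isGamma0_infConv_norm (hf : IsGamma0 f) {v : Rn n} {c r : ℝ}
    (hv : ∀ y, ((inner ℝ v y + c : ℝ) : EReal) ≤ f y) (hr : ‖v‖ ≤ r) :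
    IsGamma0 (infConv (fun p => r * ‖p‖) f) := by
  have hr0 : 0 ≤ r := (norm_nonneg v).trans hr
  obtain ⟨x₀, hx₀⟩ := hf.proper.2
  have e₀ := EReal.coe_toReal hx₀.ne (hf.proper.1 x₀)
  set F := infConv (fun p => r * ‖p‖) f with hF
  -- Since `‖v‖ ≤ r`, the affine minorant of `f` survives the regularization, which keeps `F` above
  -- `⊥`.
  have lo : ∀ x, ((inner ℝ v x + c : ℝ) : EReal) ≤ F x := fun x => by
    refine le_iInf fun y => le_trans ?_ (add_le_add_left (hv y) _)
    rw [← EReal.coe_add, EReal.coe_le_coe_iff]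
    have h1 := (abs_le.1 (abs_real_inner_le_norm v (y - x))).1
    rw [inner_sub_right] at h1
    have h2 := mul_le_mul_of_nonneg_right hr (norm_nonneg (y - x))
    linarith
  have hbot : ∀ x, F x ≠ ⊥ := fun x => ((EReal.bot_lt_coe _).trans_le (lo x)).ne'
  have htop : ∀ x, F x < ⊤ := fun x => by
    refine (infConv_le _ f x x₀).trans_lt ?_
    rw [← e₀, ← EReal.coe_add]
    exact EReal.coe_lt_top _
  have hreal : ∀ x, ((F x).toReal : EReal) = F x := fun x =>
    EReal.coe_toReal (htop x).ne (hbot x)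
  have lip : ∀ x y, (F x).toReal ≤ (F y).toReal + r * dist x y := fun x y => by
    refine le_of_forall_pos_le_add fun ε hε => ?_
    obtain ⟨z, hz⟩ := exists_of_infConv_lt (f := f) (K := fun p => r * ‖p‖) (x := y)
      (c := (F y).toReal + ε) (by
        change F y < _
        conv_lhs => rw [← hreal y]
        norm_cast
        linarith)
    have h1 := (infConv_le (fun p => r * ‖p‖) f x z).trans (add_le_add_left hz _)
    rw [← hF, ← hreal x, ← EReal.coe_add, EReal.coe_le_coe_iff] at h1
    have h2 : ‖z - x‖ ≤ ‖z - y‖ + dist x y := by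
      rw [dist_comm, dist_eq_norm]
      simpa using norm_add_le (z - y) (y - x)
    nlinarith [mul_le_mul_of_nonneg_left h2 hr0]
  refine ⟨⟨hbot, x₀, htop x₀⟩, ?_, isConvex_of_isModulusConvex_zero hbot ?_⟩
  · have hc : Continuous fun x => (F x).toReal :=
      (LipschitzWith.of_le_add_mul ⟨r, hr0⟩ lip).continuous
    have := (continuous_coe_real_ereal.comp hc).lowerSemicontinuous
    convert this using 1
    funext x
    exact (hreal x).symm
  · exact (isModulusConvex_zero hf.proper.1 hf.convex).infConv (norm_kernel_convex hr0)
      (fun p d => by simp)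

lemma IsLocBdd.coe_toReal (hg : IsLocBdd g) (x : Rn n) : ((g x).toReal : EReal) = g x :=
  EReal.coe_toReal (hg.1 x).2 (hg.1 x).1

/-- A convex function with `|g| ≤ C` on the ball of radius `R + 1` has subgradients of norm at most
`2 * C` on the ball of radius `R`. -/
lemma IsModulusConvex.le_add_mul_norm (hg : IsLocBdd g) (h : IsModulusConvex 0 g) {R C : ℝ}
    (hC : ∀ x, ‖x‖ ≤ R + 1 → |(g x).toReal| ≤ C) {x : Rn n} (hx : ‖x‖ ≤ R) (y : Rn n) :
    (g x).toReal ≤ (g y).toReal + 2 * C * ‖y - x‖ := by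
  rcases eq_or_ne y x with rfl | hne
  · simp
  have hd : 0 < ‖y - x‖ := norm_pos_iff.2 (sub_ne_zero.2 hne)
  set d := ‖y - x‖ with hd'
  -- Prolong the segment from `y` to `x` by unit length beyond `x`: `z` stays in the ball of radius
  -- `R + 1`, and `x` lies between `z` and `y` with weight `d / (1 + d)` on `z`.
  set z : Rn n := x - d⁻¹ • (y - x)
  have hz : ‖z‖ ≤ R + 1 := by
    refine (norm_sub_le _ _).trans (add_le_add hx ?_)
    rw [norm_smul, norm_inv, Real.norm_of_nonneg hd.le, ← hd', inv_mul_cancel₀ hd.ne']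
  have key := h z y _ _ (hg.coe_toReal z).ge (hg.coe_toReal y).ge (d / (1 + d)) (by positivity)
    ((div_le_one (by positivity)).2 (by linarith))
  have e : (d / (1 + d)) • z + (1 - d / (1 + d)) • y = x := by
    have h1 : d / (1 + d) * d⁻¹ = 1 - d / (1 + d) := by field_simp; ring
    simp only [z, smul_sub, smul_smul, h1]
    module
  rw [e, ← hg.coe_toReal x, EReal.coe_le_coe_iff] at key
  have hzC := (abs_le.1 (hC z hz)).2
  have hxC := (abs_le.1 (hC x (by linarith))).1
  have h2 : 1 - d / (1 + d) = 1 / (1 + d) := by field_simp; ring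
  rw [h2] at key
  have h3 := mul_le_mul_of_nonneg_left key (by positivity : 0 ≤ 1 + d)
  have h4 : (1 + d) * (d / (1 + d) * (g z).toReal + 1 / (1 + d) * (g y).toReal
      - 0 / 2 * (d / (1 + d) * (1 / (1 + d))) * ‖z - y‖ ^ 2)
      = d * (g z).toReal + (g y).toReal := by field_simp; ring
  rw [h4] at h3
  nlinarith [mul_le_mul_of_nonneg_left hzC hd.le, mul_le_mul_of_nonneg_left hxC hd.le]

/-- Lipschitz regularization of `f` changes its envelope only far away, and makes the envelope
grow at most linearly. -/
lemma exists_moreauEnvelope_eqOn_linear_growth (hf : IsGamma0 f) (R : ℝ) :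
    ∃ f' : Rn n → EReal, IsGamma0 f' ∧
      (∀ x, ‖x‖ ≤ R → moreauEnvelope 1 f' x = moreauEnvelope 1 f x) ∧
      ∃ A r : ℝ, ∀ x, moreauEnvelope 1 f' x ≤ ((A + r * ‖x‖ : ℝ) : EReal) := by
  have hg := isLocBdd_moreauEnvelope hf
  obtain ⟨v, c, hv⟩ := exists_affine_minorant_of_isGamma0 hf
  obtain ⟨C, hC⟩ := hg.2 (R + 1)
  -- The bound `‖v‖` keeps the regularization in `Γ₀`; the bound `2 * C` dominates the slopes of the
  -- envelope on the ball.
  set r := max ‖v‖ (2 * C)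
  have hr0 : 0 ≤ r := (norm_nonneg v).trans (le_max_left _ _)
  set F := infConv (fun p => r * ‖p‖) f
  have hle : ∀ x, F x ≤ f x := fun x => by
    simpa using infConv_le (fun p => r * ‖p‖) f x x
  refine ⟨F, isGamma0_infConv_norm hf hv (le_max_left _ _), fun x hx => le_antisymm ?_ ?_, ?_⟩
  · exact iInf_mono fun y => add_le_add_left (hle y) _
  · refine le_iInf fun y => ?_
    refine EReal.le_of_forall_lt_iff_le.1 fun t ht => ?_
    have ht' : F y < ((t - 1 / (2 * 1) * ‖y - x‖ ^ 2 : ℝ) : EReal) := by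
      rw [EReal.coe_sub]
      exact (EReal.lt_sub_iff_add_lt (Or.inl (EReal.coe_ne_bot _))
        (Or.inl (EReal.coe_ne_top _))).2 ht
    obtain ⟨z, hz⟩ := exists_of_infConv_lt ht'
    -- The two infimal convolutions commute: translating `x` by `z - y` keeps the quadratic cost at
    -- `‖y - x‖` and turns the cost `r * ‖z - y‖` into a displacement of the envelope's argument.
    have h1 := (moreauEnvelope_le f (z - y + x) z).trans (add_le_add_left hz _)
    have h2 := (isModulusConvex_moreauEnvelope hf).le_add_mul_norm hg hC hx (z - y + x)
    rw [← hg.coe_toReal, ← EReal.coe_add, EReal.coe_le_coe_iff] at h1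
    rw [← hg.coe_toReal, EReal.coe_le_coe_iff]
    have e1 : z - (z - y + x) = y - x := by abel
    have e2 : z - y + x - x = z - y := by abel
    rw [e1] at h1
    rw [e2] at h2
    have h3 := mul_le_mul_of_nonneg_right (le_max_right ‖v‖ (2 * C)) (norm_nonneg (z - y))
    change 2 * C * ‖z - y‖ ≤ r * ‖z - y‖ at h3
    linarith
  · obtain ⟨x₀, hx₀⟩ := hf.proper.2
    have e₀ := EReal.coe_toReal hx₀.ne (hf.proper.1 x₀)
    refine ⟨(f x₀).toReal + r * ‖x₀‖, r, fun x => ?_⟩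
    have h1 : moreauEnvelope 1 F x ≤ F x := by simpa using moreauEnvelope_le F x x
    refine h1.trans ((infConv_le _ f x x₀).trans ?_)
    rw [← e₀, ← EReal.coe_add, EReal.coe_le_coe_iff, EReal.toReal_coe]
    nlinarith [mul_le_mul_of_nonneg_left (norm_sub_le x₀ x) hr0]

/-- Testing the midpoint `0` of `±t • e`, with `e` a unit vector, gives `g 0 ≤ A + r * t - σ / 2 * t
^ 2`, which fails for large `t`. -/
lemma not_isModulusConvex_of_linear_growth (hn : 1 ≤ n) (hg : IsLocBdd g) {A r σ : ℝ}
    (hσ : 0 < σ) (h : ∀ x, g x ≤ ((A + r * ‖x‖ : ℝ) : EReal)) : ¬ IsModulusConvex σ g := by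
  intro hc
  have : Nontrivial (Rn n) := by
    have : Nonempty (Fin n) := ⟨⟨0, hn⟩⟩
    infer_instance
  obtain ⟨e, he⟩ := exists_norm_eq (Rn n) zero_le_one
  have key : ∀ t : ℝ, 0 ≤ t → (g 0).toReal ≤ A + r * t - σ / 2 * t ^ 2 := fun t ht => by
    have h1 := hc (t • e) (-(t • e)) _ _ (h _) (h _) (1 / 2) (by norm_num) (by norm_num)
    have e1 : (1 / 2 : ℝ) • (t • e) + (1 - 1 / 2 : ℝ) • (-(t • e)) = 0 := by module
    have e2 : t • e - -(t • e) = (2 * t) • e := by module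
    have e3 : ‖t • e‖ = t := by rw [norm_smul, he, mul_one, Real.norm_of_nonneg ht]
    have e4 : ‖(2 * t) • e‖ = 2 * t := by
      rw [norm_smul, he, mul_one, Real.norm_of_nonneg (by positivity)]
    rw [e1, e2, e4, norm_neg, e3, ← hg.coe_toReal 0, EReal.coe_le_coe_iff] at h1
    linarith
  have h1 := key 0 le_rfl
  -- For this `t`, the quadratic term is at least `(|r| + 1) * t`, which exceeds `r * t + (A - g 0)`
  -- because `t > A - g 0`.
  have h2 := key (2 * (|r| + 1) / σ + (A - (g 0).toReal)) (by
    have : 0 ≤ A - (g 0).toReal := by linarith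
    positivity)
  set D := A - (g 0).toReal
  have hD : 0 ≤ D := by simp only [D]; linarith
  set t := 2 * (|r| + 1) / σ + D with ht
  have h3 : σ * t = 2 * (|r| + 1) + σ * D := by rw [ht]; field_simp
  have ht0 : 0 < t := by positivity
  have htD : D < t := by rw [ht]; linarith [show 0 < 2 * (|r| + 1) / σ by positivity]
  have h4 : σ / 2 * t ^ 2 = (|r| + 1) * t + σ * D / 2 * t := by
    linear_combination (t / 2) * h3
  have h5 := mul_le_mul_of_nonneg_right (le_abs_self r) ht0.le
  have h6 : 0 ≤ σ * D / 2 * t := by positivity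
  simp only [D] at *
  linarith

/-! ### Topology of the space of envelopes -/

/-- The first `N` terms vanish, and the remaining weights sum to `(1 / 2) ^ N`. -/
lemma envDist_le_of_eqOn_ball (N : ℕ) (h : ∀ x, ‖x‖ ≤ N → f x = g x) :
    envDist f g ≤ (1 / 2) ^ N := by
  have hz : ∀ i ∈ Finset.range N,
      (1 / 2 ^ (i + 1) : ℝ) * (supDist (i + 1) f g / (1 + supDist (i + 1) f g)) = 0 := by
    intro i hi
    have : supDist (i + 1) f g = 0 := by
      have h0 : ∀ x : Metric.closedBall (0 : Rn n) ((i + 1 : ℕ) : ℝ),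
          |(f x).toReal - (g x).toReal| = 0 := fun x => by
        have hx : ‖(x : Rn n)‖ ≤ ((i + 1 : ℕ) : ℝ) := by simpa using x.2
        rw [h x (hx.trans (by exact_mod_cast Finset.mem_range.1 hi)), sub_self, abs_zero]
      simp only [supDist, h0, Real.iSup_const_zero]
    simp [this]
  rw [envDist, ← (summable_envTerm f g).sum_add_tsum_nat_add N, Finset.sum_eq_zero hz, zero_add,
    ← tsum_geometric_two' ((1 / 2 : ℝ) ^ N)]
  refine ((summable_nat_add_iff N).2 (summable_envTerm f g)).tsum_le_tsum (fun i => ?_)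
    (summable_geometric_two' _)
  have hs := supDist_nonneg (i + N + 1) f g
  refine (mul_le_of_le_one_right (by positivity) ?_).trans (le_of_eq ?_)
  · rw [div_le_one (by positivity)]
    linarith
  · rw [one_div_pow]
    field_simp
    ring

lemma continuous_toReal_eval (x : Rn n) :
    Continuous fun g : MoreauSet n => (g.toFun x).toReal := by
  obtain ⟨i, hi⟩ := exists_nat_ge ‖x‖
  -- This is the series term of index `i` evaluated at sup-distance `ε`; as `t / (1 + t)` is
  -- increasing, a smaller distance forces the sup-distance on that ball below `ε`.
  refine Metric.continuous_iff.2 fun g ε hε => ⟨1 / 2 ^ (i + 1) * (ε / (1 + ε)), by positivity,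
    fun h hh => ?_⟩
  have hS := supDist_nonneg (i + 1) h.toFun g.toFun
  have h1 : (1 / 2 ^ (i + 1) : ℝ) * (supDist (i + 1) h.toFun g.toFun /
      (1 + supDist (i + 1) h.toFun g.toFun)) ≤ dist h g :=
    (summable_envTerm h.toFun g.toFun).le_tsum i fun j _ => envTerm_nonneg _ _ j
  have h2 := lt_of_mul_lt_mul_left (h1.trans_lt hh) (by positivity)
  rw [div_lt_div_iff₀ (by positivity) (by positivity)] at h2
  have h3 := le_supDist h.isLocBdd g.isLocBdd (i + 1) (x := x) (by push_cast; linarith)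
  rw [Real.dist_eq]
  linarith

lemma isClosed_setOf_isModulusConvex (σ : ℝ) :
    IsClosed {g : MoreauSet n | IsModulusConvex σ g.toFun} := by
  have e : {g : MoreauSet n | IsModulusConvex σ g.toFun} =
      ⋂ (x : Rn n) (y : Rn n) (α : ℝ) (_ : 0 ≤ α) (_ : α ≤ 1),
        {g : MoreauSet n | (g.toFun (α • x + (1 - α) • y)).toReal ≤
          α * (g.toFun x).toReal + (1 - α) * (g.toFun y).toReal
            - σ / 2 * (α * (1 - α)) * ‖x - y‖ ^ 2} := by
    ext g
    simp only [Set.mem_ofPred_eq, Set.mem_iInter]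
    have hg := g.isLocBdd
    constructor
    · intro h x y α h0 h1
      have := h x y _ _ (hg.coe_toReal x).ge (hg.coe_toReal y).ge α h0 h1
      rwa [← hg.coe_toReal, EReal.coe_le_coe_iff] at this
    · intro h x y a b ha hb α h0 h1
      rw [← hg.coe_toReal, EReal.coe_le_coe_iff] at ha hb ⊢
      have h2 := mul_le_mul_of_nonneg_left ha h0
      have h3 := mul_le_mul_of_nonneg_left hb (sub_nonneg.2 h1)
      have h4 := h x y α h0 h1
      linarith
  rw [e]
  refine isClosed_iInter fun x => isClosed_iInter fun y => isClosed_iInter fun α =>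
    isClosed_iInter fun _ => isClosed_iInter fun _ => isClosed_le (continuous_toReal_eval _) ?_
  exact ((continuous_const.mul (continuous_toReal_eval x)).add
    (continuous_const.mul (continuous_toReal_eval y))).sub continuous_const

lemma isNowhereDense_setOf_isModulusConvex (hn : 1 ≤ n) {σ : ℝ} (hσ : 0 < σ) :
    IsNowhereDense {g : MoreauSet n | IsModulusConvex σ g.toFun} := by
  rw [(isClosed_setOf_isModulusConvex σ).isNowhereDense_iff, Set.eq_empty_iff_forall_notMem]
  intro g hg
  obtain ⟨ε, hε, hball⟩ := Metric.mem_nhds_iff.1 (mem_interior_iff_mem_nhds.1 hg)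
  -- Agreement on the ball of radius `N` alone brings the modified envelope within `ε` of `g`.
  obtain ⟨N, hN⟩ := exists_pow_lt_of_lt_one hε (by norm_num : (1 / 2 : ℝ) < 1)
  obtain ⟨f, hf, hgf⟩ := g.exists_eq
  obtain ⟨f', hf', heq, A, r, hgrow⟩ := exists_moreauEnvelope_eqOn_linear_growth hf N
  refine not_isModulusConvex_of_linear_growth hn (isLocBdd_moreauEnvelope hf') hσ hgrow
    (hball (a := ⟨moreauEnvelope 1 f', f', hf', rfl⟩) ?_)
  refine Metric.mem_ball.2 (lt_of_le_of_lt (envDist_le_of_eqOn_ball N fun x hx => ?_) hN)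
  rw [hgf]
  exact heq x hx

lemma isMeagre_setOf_exists_isModulusConvex (hn : 1 ≤ n) :
    IsMeagre {g : MoreauSet n | ∃ σ : ℝ, 0 < σ ∧ IsModulusConvex σ g.toFun} := by
  refine (isMeagre_iUnion fun k : ℕ => (isNowhereDense_setOf_isModulusConvex hn
    (Nat.one_div_pos_of_nat (α := ℝ) (n := k))).isMeagre).mono ?_
  rintro g ⟨σ, hσ, hg⟩
  obtain ⟨k, hk⟩ := exists_nat_one_div_lt hσ
  exact Set.mem_iUnion.2 ⟨k, hg.mono hk.le⟩

/-- Taking Moreau envelopes is an isometry of `Γ₀` onto the set of Moreau envelopes. -/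
noncomputable def envelopeIsometryEquiv (n : ℕ) : Gamma0 n ≃ᵢ MoreauSet n :=
  IsometryEquiv.mk
    (Equiv.ofBijective (fun f => ⟨moreauEnvelope 1 f.toFun, f.toFun, f.isGamma0, rfl⟩)
      ⟨fun f g h => Gamma0.ext
        (moreauEnvelope_injective f.isGamma0 g.isGamma0 (congrArg MoreauSet.toFun h)),
       fun g => by
        obtain ⟨f, hf, h⟩ := g.exists_eq
        exact ⟨⟨f, hf⟩, MoreauSet.ext h.symm⟩⟩)
    (Isometry.of_dist_eq fun _ _ => rfl)

end MoreauSpace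

theorem theorem4p11 (n : ℕ) (hn : 1 ≤ n) :
    IsMeagre {g : MoreauSpace.MoreauSet n | MoreauSpace.IsStronglyConvex g.toFun} ∧
      IsMeagre {f : MoreauSpace.Gamma0 n | MoreauSpace.IsStronglyConvex f.toFun} := by
  have h := MoreauSpace.isMeagre_setOf_exists_isModulusConvex hn
  constructor
  · refine h.mono ?_
    rintro g ⟨σ, hσ, hg⟩
    exact ⟨σ, hσ, MoreauSpace.isModulusConvex_of_isConvex_sub (fun x => (g.isLocBdd.1 x).1) hg⟩
  · let Φ := MoreauSpace.envelopeIsometryEquiv n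
    -- Meagreness pulls back along a continuous open map, so only the passage of strong convexity
    -- from `f` to its envelope is needed, not the converse.
    refine (h.preimage_of_isOpenMap Φ.continuous Φ.toHomeomorph.isOpenMap).mono ?_
    rintro f ⟨σ, hσ, hf⟩
    exact ⟨σ / (1 + σ), by positivity,
      (MoreauSpace.isModulusConvex_of_isConvex_sub f.isGamma0.proper.1 hf).moreauEnvelope hσ.le⟩
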